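/- Let $\ell,p\ge 1$ be integers, let $\mathbb{F}_\ell$ be the free group on $\ell$ generators with identity $e$, and let $\mathcal{H}=\ell^2(\mathbb{F}_\ell;\mathbb{C}^p)$, with the unitary representation $(U_0(g)f)(w)=f(g^{-1}w)$ of $\mathbb{F}_\ell$. Let $\mathcal{V}$ be the von Neumann algebra of all bounded operators on $\mathcal{H}$ that commute with every $U_0(g)$, $g\in\mathbb{F}_\ell$. For $B\in\mathcal{V}$ let $\widehat{B}:\mathbb{F}_\ell\to\hom(\mathbb{C}^p)$ be given by $\widehat{B}(g)\varphi=(B\delta_{e;\varphi})(g)$, where $\delta_{e;\varphi}$ is the function supported at $e$ with value $\varphi$ there; thus $(Bf)(g)=\sum_{h\in\mathbb{F}_\ell}\widehat{B}(h^{-1}g)f(h)$. Let $T(B)=\mathrm{Tr}(\widehat{B}(e))$ be the unnormalized trace, and let $C^*_{red}(\mathbb{F}_\ell;\mathbb{C}^p)$ be the operator-norm closure of the $*$-algebra of those $B\in\mathcal{V}$ for which $\{w \mid \widehat{B}(w)\neq 0\}$ is finite. Theorem. If $P\in C^*_{red}(\mathbb{F}_\ell;\mathbb{C}^p)$ is an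 orthogonal projection, then $T(P)\in\mathbb{Z}$. -/

import Mathlib

namespace FreeGroupAlgebra

open scoped ENNReal Pointwise

/-- The Hilbert space `ℓ²(F_ℓ; ℂᵖ)` of square summable functions on the free group on `ℓ`
generators (the vertex set of its Cayley graph, the `2ℓ`-regular tree) with values in `ℂᵖ`. -/
abbrev HSpace (ℓ p : ℕ) : Type :=
  lp (fun _ : FreeGroup (Fin ℓ) => EuclideanSpace ℂ (Fin p)) 2

variable {ℓ p : ℕ}

theorem memℓp_translate (g : FreeGroup (Fin ℓ)) (f : HSpace ℓ p) :
    Memℓp (fun w : FreeGroup (Fin ℓ) => f (g⁻¹ * w)) 2 := by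
  have h2 : (0 : ℝ) < (2 : ℝ≥0∞).toReal := by norm_num
  refine (memℓp_gen_iff h2).2 ?_
  exact (Equiv.mulLeft g⁻¹).summable_iff.2 ((memℓp_gen_iff h2).1 (lp.memℓp f))

/-- The left regular representation with multiplicity `p`: `(U₀(g) f)(w) = f(g⁻¹ w)`,
as a unitary operator on `ℓ²(F_ℓ; ℂᵖ)`. -/
noncomputable def U₀ (g : FreeGroup (Fin ℓ)) : HSpace ℓ p ≃ₗᵢ[ℂ] HSpace ℓ p where
  toFun f := ⟨fun w => f (g⁻¹ * w), memℓp_translate g f⟩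
  invFun f := ⟨fun w => f (g⁻¹⁻¹ * w), memℓp_translate g⁻¹ f⟩
  map_add' _ _ := rfl
  map_smul' _ _ := rfl
  left_inv f := by ext w : 2; simp
  right_inv f := by ext w : 2; simp
  norm_map' f := by
    have h2 : (0 : ℝ) < (2 : ℝ≥0∞).toReal := by norm_num
    rw [lp.norm_eq_tsum_rpow h2, lp.norm_eq_tsum_rpow h2]
    congr 1
    exact (Equiv.mulLeft g⁻¹).tsum_eq (fun w => ‖f w‖ ^ (2 : ℝ≥0∞).toReal)

@[simp]
theorem U₀_apply (g : FreeGroup (Fin ℓ)) (f : HSpace ℓ p) (w : FreeGroup (Fin ℓ)) :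
    U₀ g f w = f (g⁻¹ * w) := rfl

/-- `U₀(g)` as a bounded operator. -/
noncomputable def U₀L (ℓ p : ℕ) (g : FreeGroup (Fin ℓ)) : HSpace ℓ p →L[ℂ] HSpace ℓ p :=
  (U₀ g).toContinuousLinearEquiv.toContinuousLinearMap

@[simp]
theorem U₀L_apply (g : FreeGroup (Fin ℓ)) (f : HSpace ℓ p) (w : FreeGroup (Fin ℓ)) :
    U₀L ℓ p g f w = f (g⁻¹ * w) := rfl

/-- The von Neumann algebra `𝒱_{2ℓ;p}` of all bounded operators on `ℓ²(F_ℓ; ℂᵖ)` commuting with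
`{U₀(g) | g ∈ F_ℓ}`. -/
noncomputable def V (ℓ p : ℕ) : VonNeumannAlgebra (HSpace ℓ p) where
  toStarSubalgebra := StarSubalgebra.centralizer ℂ (Set.range (U₀L ℓ p))
  centralizer_centralizer' := by simp

theorem star_U₀L (g : FreeGroup (Fin ℓ)) : star (U₀L ℓ p g) = U₀L ℓ p g⁻¹ := by
  rw [ContinuousLinearMap.star_eq_adjoint]
  refine ((ContinuousLinearMap.eq_adjoint_iff _ _).2 fun x y => ?_).symm
  rw [← LinearIsometryEquiv.inner_map_map (U₀ g)]
  congr 1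
  ext w : 2
  simp

theorem mem_V_iff {B : HSpace ℓ p →L[ℂ] HSpace ℓ p} :
    B ∈ V ℓ p ↔ ∀ g : FreeGroup (Fin ℓ), U₀L ℓ p g * B = B * U₀L ℓ p g := by
  change B ∈ (Set.range (U₀L ℓ p) ∪ star (Set.range (U₀L ℓ p))).centralizer ↔ _
  rw [Set.mem_centralizer_iff]
  constructor
  · intro h g
    exact h _ (Or.inl ⟨g, rfl⟩)
  · rintro h _ (⟨g, rfl⟩ | ⟨g, hg⟩)
    · exact h g
    · have := h g⁻¹
      rwa [← star_U₀L, hg, star_star] at this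

/-- The symbol `B̂ : F_ℓ → hom(ℂᵖ)`, given by `B̂(g) φ = (B δ_{e;φ})(g)`, where `δ_{e;φ}` is the
function supported at the identity with the value `φ` there. -/
noncomputable def hat (B : HSpace ℓ p →L[ℂ] HSpace ℓ p) (g : FreeGroup (Fin ℓ)) :
    EuclideanSpace ℂ (Fin p) →L[ℂ] EuclideanSpace ℂ (Fin p) :=
  (lp.evalCLM ℂ (fun _ : FreeGroup (Fin ℓ) => EuclideanSpace ℂ (Fin p)) 2 g).comp
    (B.comp (lp.singleContinuousLinearMap ℂ
      (fun _ : FreeGroup (Fin ℓ) => EuclideanSpace ℂ (Fin p)) 2 1))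

theorem hat_apply (B : HSpace ℓ p →L[ℂ] HSpace ℓ p) (g : FreeGroup (Fin ℓ))
    (φ : EuclideanSpace ℂ (Fin p)) : hat B g φ = B (lp.single 2 1 φ) g := rfl

theorem apply_single {B : HSpace ℓ p →L[ℂ] HSpace ℓ p} (hB : B ∈ V ℓ p)
    (h g : FreeGroup (Fin ℓ)) (φ : EuclideanSpace ℂ (Fin p)) :
    B (lp.single 2 h φ) g = hat B (h⁻¹ * g) φ := by
  have e : (lp.single 2 h φ : HSpace ℓ p) = U₀L ℓ p h (lp.single 2 1 φ) := by
    ext w : 2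
    rw [U₀L_apply, lp.coeFn_single, lp.coeFn_single]
    by_cases hw : w = h
    · subst hw; simp
    · have h' : h⁻¹ * w ≠ 1 := fun h0 => hw (by rw [inv_mul_eq_one] at h0; exact h0.symm)
      rw [Pi.single_eq_of_ne hw, Pi.single_eq_of_ne h']
  have hc := congrArg (fun A : HSpace ℓ p →L[ℂ] HSpace ℓ p => A (lp.single 2 1 φ) g)
    (mem_V_iff.1 hB h)
  rw [e, hat_apply]
  exact hc.symm

/-- Operators in `𝒱_{2ℓ;p}` are convolution operators:
`(B f)(g) = ∑_h B̂(h⁻¹ g) f(h)`. -/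
theorem hasSum_hat {B : HSpace ℓ p →L[ℂ] HSpace ℓ p} (hB : B ∈ V ℓ p) (f : HSpace ℓ p)
    (g : FreeGroup (Fin ℓ)) : HasSum (fun h => hat B (h⁻¹ * g) (f h)) (B f g) := by
  have h1 := lp.hasSum_single (p := 2) (by norm_num) f
  have h2 := ((lp.evalCLM ℂ (fun _ : FreeGroup (Fin ℓ) => EuclideanSpace ℂ (Fin p)) 2 g).comp
    B).hasSum h1
  have e : (fun h => hat B (h⁻¹ * g) (f h)) = fun h => B (lp.single 2 h (f h)) g :=
    funext fun h => (apply_single hB h g (f h)).symm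
  rw [e]
  exact h2

theorem hat_star {B : HSpace ℓ p →L[ℂ] HSpace ℓ p} (hB : B ∈ V ℓ p) (w : FreeGroup (Fin ℓ)) :
    hat (star B) w = star (hat B w⁻¹) := by
  rw [ContinuousLinearMap.star_eq_adjoint, ContinuousLinearMap.star_eq_adjoint,
    ContinuousLinearMap.eq_adjoint_iff]
  intro x y
  have h : inner ℂ (ContinuousLinearMap.adjoint B (lp.single 2 1 x)) (lp.single 2 w y) =
      inner ℂ (lp.single 2 1 x) (B (lp.single 2 w y)) :=
    ContinuousLinearMap.adjoint_inner_left _ _ _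
  rw [lp.inner_single_left, lp.inner_single_right, apply_single hB, mul_one] at h
  exact h

/-- The `*`-algebra `𝒞⁽⁰⁾_{2ℓ;p}` of all `B ∈ 𝒱_{2ℓ;p}` with `{w | B̂(w) ≠ 0}` finite. -/
noncomputable def C0 (ℓ p : ℕ) : StarSubalgebra ℂ (HSpace ℓ p →L[ℂ] HSpace ℓ p) where
  carrier := {B | B ∈ V ℓ p ∧ {w | hat B w ≠ 0}.Finite}
  mul_mem' := by
    rintro B C ⟨hB, hB'⟩ ⟨hC, hC'⟩
    refine ⟨mul_mem hB hC, (hC'.mul hB').subset ?_⟩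
    intro w hw
    by_contra hn
    refine hw ?_
    ext1 φ
    have h := hasSum_hat hB (C (lp.single 2 1 φ)) w
    refine h.unique ?_
    change HasSum _ 0
    convert hasSum_zero with u
    by_cases h1 : hat C u = 0
    · rw [← hat_apply, h1]; simp
    · by_cases h2 : hat B (u⁻¹ * w) = 0
      · rw [h2]; simp
      · exact absurd (Set.mem_mul.2 ⟨u, h1, u⁻¹ * w, h2, by simp⟩) hn
  add_mem' := by
    rintro B C ⟨hB, hB'⟩ ⟨hC, hC'⟩
    refine ⟨add_mem hB hC, (hB'.union hC').subset ?_⟩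
    intro w hw
    by_contra hn
    simp only [Set.mem_union, Set.mem_ofPred_eq, not_or, not_not] at hn
    refine hw ?_
    have : hat (B + C) w = hat B w + hat C w := rfl
    rw [this, hn.1, hn.2, add_zero]
  algebraMap_mem' := by
    intro c
    refine ⟨algebraMap_mem (V ℓ p).toStarSubalgebra c, (Set.finite_singleton 1).subset ?_⟩
    intro w hw
    by_contra hn
    refine hw ?_
    ext1 φ
    rw [hat_apply, Algebra.algebraMap_eq_smul_one]
    change c • (lp.single 2 1 φ : HSpace ℓ p) w = 0
    rw [lp.coeFn_single, Pi.single_eq_of_ne hn, smul_zero]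
  star_mem' := by
    rintro B ⟨hB, hB'⟩
    refine ⟨star_mem hB, hB'.inv.subset ?_⟩
    intro w hw h0
    refine hw ?_
    rw [hat_star hB, h0, ContinuousLinearMap.star_eq_adjoint, map_zero]

/-- `C*_red(F_ℓ; ℂᵖ)`: the operator-norm closure of `𝒞⁽⁰⁾_{2ℓ;p}`. -/
noncomputable def Cred (ℓ p : ℕ) : StarSubalgebra ℂ (HSpace ℓ p →L[ℂ] HSpace ℓ p) :=
  (C0 ℓ p).topologicalClosure

/-- The unnormalized trace `T(B) = Tr(B̂(e))`, with `Tr` the trace on `hom(ℂᵖ)`. -/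
noncomputable def T (B : HSpace ℓ p →L[ℂ] HSpace ℓ p) : ℂ :=
  LinearMap.trace ℂ (EuclideanSpace ℂ (Fin p)) (hat B 1).toLinearMap

end FreeGroupAlgebra

/-!
The free group acts on its Cayley tree. In a tree, sending an edge to its endpoint farther from the
root is a bijection from the edges to the vertices other than the root. Transporting the action of
an operator `B` of `𝒱` on edges (`ℓ` copies of `ℓ²(F_ℓ; ℂᵖ)`) along this bijection gives an operator
`onEdges B` on `ℓ²(F_ℓ; ℂᵖ)`, and `B ↦ onEdges B` is a bounded, non-unital `*`-homomorphism. The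
difference `defect B = B - onEdges B` has zero diagonal away from the root, and its block at the
root is `B̂(e)`; so its trace along the standard basis is `T(B)` (`hasSum_inner_defect`). A
translation of the tree respects far ends except on a finite geodesic, so `defect B` has finite rank
when `B̂` has finite support (`finiteDimensional_range_defect`).

If `X` is a projection, `defect X` is a difference of two projections. The trace of such a
difference is an integer if it makes sense: its square commutes with both projections, and on each
of its finite-dimensional spectral subspaces the trace is a difference of two ranks. Trace class
operators are avoided by a quantitative form: an operator of rank at most `r` within `ε` of a
difference of two projections has trace within `6rε` of an integer
(`exists_int_norm_trace_sub_le`).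

A projection `P` in the norm closure is approximated by a self-adjoint `B` of finite support. The
Newton iteration `b ↦ 3b² - 2b³` from `B` stays in the algebra of finitely supported operators and
converges to a projection `X` near `P`, with error at most `4⁻ⁿ`
(`exists_isStarProjection_newton`), while the rank of the defect of the `n`-th iterate is at most
`3ⁿ` times that of `B` (`finrank_range_defect_newtonStep_le`). Since `(3/4)ⁿ → 0`, the value `T(X)`
is a limit of integers. Finally `T(X) = T(P)`, because nearby projections of `𝒱` are similar in `𝒱`
and `T` is a trace (`T_eq_of_norm_sub_le`).
-/

namespace FreeGroupAlgebra

open scoped ENNReal Pointwise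

/-! ### Traces of operators of finite rank, and differences of projections -/

section Hilbert

variable {H : Type*} [NormedAddCommGroup H] [InnerProductSpace ℂ H] [CompleteSpace H]
  {ι : Type*}

/-- The trace of an operator with values in a finite-dimensional subspace `U`, computed along a
Hilbert basis of the whole space, agrees with the trace computed in `U`. -/
theorem hasSum_inner_apply (b : HilbertBasis ι ℂ H) (K : H →L[ℂ] H) (U : Submodule ℂ H)
    (hU : ∀ x, K x ∈ U) {m : Type*} [Fintype m] (u : OrthonormalBasis m ℂ U) :
    HasSum (fun i => inner ℂ (b i) (K (b i))) (∑ j, inner ℂ (u j : H) (K (u j))) := by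
  have key : ∀ x : H, K x = ∑ j, inner ℂ (u j : H) (K x) • (u j : H) := by
    intro x
    have h := congrArg (Subtype.val) (u.sum_repr' ⟨K x, hU x⟩)
    simp only [Submodule.coe_sum, Submodule.coe_smul, Submodule.coe_inner] at h
    exact h.symm
  have h1 : ∀ j, HasSum (fun i => inner ℂ (K.adjoint (u j : H)) (b i) * inner ℂ (b i) (u j : H))
      (inner ℂ (u j : H) (K (u j))) := by
    intro j
    rw [← ContinuousLinearMap.adjoint_inner_left]
    exact b.hasSum_inner_mul_inner _ _
  refine (hasSum_sum (s := Finset.univ) fun j _ => h1 j).congr_fun fun i => ?_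
  conv_lhs => rw [key (b i), inner_sum]
  refine Finset.sum_congr rfl fun j _ => ?_
  rw [inner_smul_right, ContinuousLinearMap.adjoint_inner_left]

omit [CompleteSpace H] in
theorem norm_sum_inner_apply_le (K : H →L[ℂ] H) {U : Submodule ℂ H} {m : Type*} [Fintype m]
    (u : OrthonormalBasis m ℂ U) :
    ‖∑ j, inner ℂ (u j : H) (K (u j))‖ ≤ Module.finrank ℂ U * ‖K‖ := by
  refine (norm_sum_le _ _).trans ?_
  rw [Module.finrank_eq_card_basis u.toBasis, ← nsmul_eq_mul]
  refine Finset.sum_le_card_nsmul _ _ _ fun j _ => ?_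
  have h1 : ‖(u j : H)‖ = 1 := u.orthonormal.1 j
  refine (norm_inner_le_norm _ _).trans ?_
  have := K.le_opNorm (u j)
  rw [h1, mul_one] at this
  rwa [h1, one_mul]

/-- The spectral subspace of `|D|` for the interval `(δ, ∞)`, as the range of the positive part of
`D² - δ²`: on it `D` is bounded below by `δ`, on its complement `D` is bounded above by `δ`, and
every operator commuting with `D²` leaves it invariant. -/
theorem exists_spectral_subspace {D : H →L[ℂ] H} (hD : IsSelfAdjoint D) {δ : ℝ} (hδ : 0 ≤ δ) :
    ∃ W : Submodule ℂ H, (∀ v ∈ W, δ * ‖v‖ ≤ ‖D v‖) ∧ (∀ v ∈ Wᗮ, ‖D v‖ ≤ δ * ‖v‖) ∧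
      ∀ X : H →L[ℂ] H, Commute X (D * D) → ∀ v ∈ W, X v ∈ W := by
  set A : H →L[ℂ] H := D * D - ((δ ^ 2 : ℝ) : ℂ) • 1 with hA
  have hAsa : IsSelfAdjoint A := by
    refine IsSelfAdjoint.sub ?_ ?_
    · simpa [hD.star_eq] using IsSelfAdjoint.star_mul_self D
    · refine IsSelfAdjoint.smul ?_ (IsSelfAdjoint.one _)
      simp [IsSelfAdjoint]
  have hinner : ∀ v, (inner ℂ (A v) v).re = ‖D v‖ ^ 2 - δ ^ 2 * ‖v‖ ^ 2 := by
    intro v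
    have h1 : inner ℂ (D (D v)) v = inner ℂ (D v) (D v) := by
      have h := ContinuousLinearMap.adjoint_inner_left D v (D v)
      rwa [← ContinuousLinearMap.star_eq_adjoint, hD.star_eq] at h
    have h2 : A v = D (D v) - ((δ ^ 2 : ℝ) : ℂ) • v := rfl
    rw [h2, inner_sub_left, inner_smul_left, h1, Complex.conj_ofReal, Complex.sub_re,
      Complex.re_ofReal_mul]
    have h3 := inner_self_eq_norm_sq (𝕜 := ℂ) (D v)
    have h4 := inner_self_eq_norm_sq (𝕜 := ℂ) v
    simp only [RCLike.re_to_complex] at h3 h4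
    rw [h3, h4]
  have hpos : ∀ {Q : H →L[ℂ] H}, 0 ≤ Q → ∀ v, 0 ≤ (inner ℂ (Q v) v).re := by
    intro Q hQ v
    exact ((ContinuousLinearMap.nonneg_iff_isPositive Q).1 hQ).re_inner_nonneg_left v
  have hsub : A⁺ - A⁻ = A := CFC.posPart_sub_negPart A hAsa
  have hPsa : IsSelfAdjoint A⁺ := (CFC.posPart_nonneg A).isSelfAdjoint
  refine ⟨LinearMap.range (A⁺).toLinearMap, ?_, ?_, ?_⟩
  · rintro _ ⟨u, rfl⟩
    set v : H := A⁺ u with hv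
    change δ * ‖v‖ ≤ ‖D v‖
    have h0 : A v = A⁺ v := by
      have h1 : A⁻ v = 0 := congrArg (fun Q : H →L[ℂ] H => Q u) (CFC.negPart_mul_posPart A)
      have h2 := congrArg (fun Q : H →L[ℂ] H => Q v) hsub
      simp only [sub_apply, h1, sub_zero] at h2
      exact h2.symm
    have h1 := hpos (CFC.posPart_nonneg A) v
    rw [← h0, hinner] at h1
    refine le_of_sq_le_sq ?_ (norm_nonneg _)
    rw [mul_pow]
    linarith
  · intro v hv
    have h1 : A⁺ v = 0 := by
      rw [← inner_self_eq_zero (𝕜 := ℂ)]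
      have h := ContinuousLinearMap.adjoint_inner_left A⁺ (A⁺ v) v
      rw [← ContinuousLinearMap.star_eq_adjoint, hPsa.star_eq] at h
      rw [h]
      exact (Submodule.mem_orthogonal' _ _).1 hv _ ⟨_, rfl⟩
    have h0 : A v = - A⁻ v := by
      have h2 := congrArg (fun Q : H →L[ℂ] H => Q v) hsub
      simp only [sub_apply, h1, zero_sub] at h2
      exact h2.symm
    have h2 := hpos (CFC.negPart_nonneg A) v
    have h3 := hinner v
    rw [h0, inner_neg_left, Complex.neg_re] at h3
    refine le_of_sq_le_sq ?_ (by positivity)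
    rw [mul_pow]
    linarith
  · rintro X hX _ ⟨u, rfl⟩
    have hXA : Commute A X := by
      refine (hX.symm).sub_left ?_
      exact (Commute.one_left X).smul_left _
    have h : Commute A⁺ X := by
      rw [CFC.posPart_def]
      exact hXA.cfcₙ_real _
    exact ⟨X u, congrArg (fun Q : H →L[ℂ] H => Q u) h.eq⟩

omit [CompleteSpace H] in
/-- The trace of an idempotent on a finite-dimensional invariant subspace is its rank there. -/
theorem exists_nat_sum_inner_of_idempotent {X : H →L[ℂ] H} (hX : IsIdempotentElem X)
    {W : Submodule ℂ H} [FiniteDimensional ℂ W] (hW : ∀ v ∈ W, X v ∈ W)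
    {m : Type*} [Fintype m] (w : OrthonormalBasis m ℂ W) :
    ∃ n : ℕ, ∑ j, inner ℂ (w j : H) (X (w j)) = n := by
  classical
  let Y : W →ₗ[ℂ] W := X.toLinearMap.restrict hW
  have hY : IsIdempotentElem Y := by
    ext v
    exact congrArg (fun Q : H →L[ℂ] H => Q v) hX.eq
  refine ⟨Module.finrank ℂ (LinearMap.range Y), ?_⟩
  rw [← ((LinearMap.isProj_range_iff_isIdempotentElem Y).2 hY).trace,
    LinearMap.trace_eq_sum_inner Y w]
  rfl

/-- If the difference of two orthogonal projections is within `ε` of an operator of rank at most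
`r`, then the trace of that operator is within `6rε` of an integer.

The square of the difference commutes with both projections, so they restrict to the spectral
subspace `W` on which the absolute value of the difference exceeds `2ε`. Its dimension is at most
`r`, and the trace of the difference on `W` is an integer; off `W` everything is small. -/
theorem exists_int_norm_trace_sub_le (b : HilbertBasis ι ℂ H) {X Y K : H →L[ℂ] H}
    (hX : IsStarProjection X) (hY : IsStarProjection Y) {r : ℕ}
    [FiniteDimensional ℂ (LinearMap.range K.toLinearMap)]
    (hr : Module.finrank ℂ (LinearMap.range K.toLinearMap) ≤ r)
    {ε : ℝ} (hε : 0 < ε) (hK : ‖X - Y - K‖ ≤ ε) {t : ℂ}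
    (ht : HasSum (fun i => inner ℂ (b i) (K (b i))) t) :
    ∃ k : ℤ, ‖t - k‖ ≤ 6 * r * ε := by
  set D := X - Y with hDdef
  have hX2 : X * X = X := hX.isIdempotentElem
  have hY2 : Y * Y = Y := hY.isIdempotentElem
  have hD : IsSelfAdjoint D := hX.isSelfAdjoint.sub hY.isSelfAdjoint
  have hXD : Commute X (D * D) := by
    change X * ((X - Y) * (X - Y)) = (X - Y) * (X - Y) * X
    have h1 : X * ((X - Y) * (X - Y)) = X * X * X - X * X * Y - X * Y * X + X * (Y * Y) := by
      noncomm_ring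
    have h2 : (X - Y) * (X - Y) * X = X * X * X - X * Y * X - Y * (X * X) + Y * Y * X := by
      noncomm_ring
    rw [h1, h2]; simp only [hX2, hY2]; abel
  have hYD : Commute Y (D * D) := by
    change Y * ((X - Y) * (X - Y)) = (X - Y) * (X - Y) * Y
    have h1 : Y * ((X - Y) * (X - Y)) = Y * (X * X) - Y * X * Y - Y * Y * X + Y * Y * Y := by
      noncomm_ring
    have h2 : (X - Y) * (X - Y) * Y = X * X * Y - X * (Y * Y) - Y * X * Y + Y * Y * Y := by
      noncomm_ring
    rw [h1, h2]; simp only [hX2, hY2]; abel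
  obtain ⟨W, hW1, hW2, hW3⟩ := exists_spectral_subspace hD (δ := 2 * ε) (by positivity)
  have hXW := hW3 X hXD
  have hYW := hW3 Y hYD
  have hDW : ∀ v ∈ W, D v ∈ W := fun v hv => W.sub_mem (hXW v hv) (hYW v hv)
  -- `K` is injective on `W`, since it is closer to `D` than the lower bound for `D` there
  let KW : W →ₗ[ℂ] LinearMap.range K.toLinearMap := K.toLinearMap.rangeRestrict ∘ₗ W.subtype
  have hinj : Function.Injective KW := by
    rw [injective_iff_map_eq_zero]
    intro v hv
    have h0 : K v = 0 := congrArg Subtype.val hv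
    have h1 := hW1 v v.2
    have h2 := (D - K).le_of_opNorm_le hK (v : H)
    rw [sub_apply, h0, sub_zero] at h2
    have h3 : ‖(v : H)‖ = 0 := by
      have := norm_nonneg (v : H)
      by_contra hne
      have : 0 < ε * ‖(v : H)‖ := mul_pos hε (lt_of_le_of_ne this (Ne.symm hne))
      linarith
    exact Subtype.ext (norm_eq_zero.1 h3)
  have : FiniteDimensional ℂ W := FiniteDimensional.of_injective KW hinj
  have hWr : Module.finrank ℂ W ≤ r := (LinearMap.finrank_le_finrank_of_injective hinj).trans hr
  let w := stdOrthonormalBasis ℂ W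
  obtain ⟨n₁, hn₁⟩ := exists_nat_sum_inner_of_idempotent hX.isIdempotentElem hXW w
  obtain ⟨n₂, hn₂⟩ := exists_nat_sum_inner_of_idempotent hY.isIdempotentElem hYW w
  let E : H →L[ℂ] H := W.starProjection
  have hE : ∀ v, E v ∈ W := fun v => W.starProjection_apply_mem v
  have s1 := hasSum_inner_apply b (D * E) W (fun x => hDW _ (hE x)) w
  have hk : ∑ j, inner ℂ (w j : H) ((D * E) (w j)) = (n₁ : ℂ) - n₂ := by
    rw [← hn₁, ← hn₂, ← Finset.sum_sub_distrib]
    refine Finset.sum_congr rfl fun j _ => ?_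
    have : E (w j) = w j := Submodule.starProjection_eq_self_iff.2 (w j).2
    rw [mul_apply_eq_comp, this, ← inner_sub_right]
    rfl
  rw [hk] at s1
  -- the remainder `K - D E` has rank at most `2r` and norm at most `3ε`
  let U : Submodule ℂ H := LinearMap.range K.toLinearMap ⊔ W
  have hU : ∀ x, (K - D * E) x ∈ U := fun x =>
    U.sub_mem (Submodule.mem_sup_left ⟨x, rfl⟩) (Submodule.mem_sup_right (hDW _ (hE x)))
  let u := stdOrthonormalBasis ℂ U
  have s2 := hasSum_inner_apply b (K - D * E) U hU u
  have s3 := ht.sub s1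
  simp only [← inner_sub_right] at s3
  have heq := s3.unique s2
  have hUr : (Module.finrank ℂ U : ℝ) ≤ 2 * r := by
    have h := Submodule.finrank_add_le_finrank_add_finrank (LinearMap.range K.toLinearMap) W
    have h' : Module.finrank ℂ U ≤ r + r := h.trans (add_le_add hr hWr)
    calc (Module.finrank ℂ U : ℝ) ≤ ((r + r : ℕ) : ℝ) := by exact_mod_cast h'
      _ = 2 * r := by push_cast; ring
  have hnorm : ‖K - D * E‖ ≤ 3 * ε := by
    refine ContinuousLinearMap.opNorm_le_bound _ (by positivity) fun v => ?_
    have hv : v - E v ∈ Wᗮ := W.sub_starProjection_mem_orthogonal v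
    have h1 := hW2 _ hv
    have h2 := (D - K).le_of_opNorm_le hK v
    have h3 : ‖v - E v‖ ≤ ‖v‖ := by
      have h := W.norm_sq_eq_add_norm_sq_starProjection v
      rw [Submodule.starProjection_orthogonal_val] at h
      refine le_of_sq_le_sq ?_ (norm_nonneg _)
      have := sq_nonneg ‖W.starProjection v‖
      linarith
    have h4 : (K - D * E) v = D (v - E v) - (D - K) v := by
      simp [map_sub]
    rw [h4]
    refine (norm_sub_le _ _).trans ?_
    nlinarith
  refine ⟨(n₁ : ℤ) - n₂, ?_⟩
  push_cast
  rw [heq]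
  refine (norm_sum_inner_apply_le _ u).trans ?_
  calc (Module.finrank ℂ U : ℝ) * ‖K - D * E‖ ≤ (2 * r) * (3 * ε) := by gcongr
    _ = 6 * r * ε := by ring

end Hilbert

/-! ### Approximate projections in a C*-algebra -/

section CStar

variable {A : Type*} [CStarAlgebra A]

theorem norm_star_mul_mul_le {a : A} (ha : ‖a‖ ≤ 1) (b : A) : ‖star a * b * a‖ ≤ ‖b‖ := by
  have h2 := norm_mul_le (star a * b) a
  have h3 := norm_mul_le (star a) b
  rw [norm_star] at h3
  have h4 : ‖a‖ * ‖b‖ ≤ 1 * ‖b‖ := by gcongr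
  have h5 : ‖star a * b‖ * ‖a‖ ≤ ‖star a * b‖ * 1 := by gcongr
  linarith

theorem norm_half_add_star_sub_le (c : A) {P : A} (hP : IsSelfAdjoint P) :
    ‖(2⁻¹ : ℂ) • (c + star c) - P‖ ≤ ‖c - P‖ := by
  have e : (2⁻¹ : ℂ) • (c + star c) - P = (2⁻¹ : ℂ) • ((c - P) + star (c - P)) := by
    rw [star_sub, hP.star_eq]
    module
  have h1 := norm_add_le (c - P) (star (c - P))
  rw [norm_star] at h1
  have h2 : ‖(2⁻¹ : ℂ)‖ = 2⁻¹ := by norm_num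
  rw [e, norm_smul, h2]
  linarith

/-- One Newton step `b ↦ 3b² - 2b³` towards an idempotent. -/
def newtonStep (b : A) : A := 3 • (b * b) - 2 • (b * b * b)

theorem isSelfAdjoint_newtonStep {b : A} (hb : IsSelfAdjoint b) :
    IsSelfAdjoint (newtonStep b) := by
  simp only [newtonStep, IsSelfAdjoint, star_sub, star_nsmul, star_mul, hb.star_eq, mul_assoc]

/-- A Newton step squares the defect `b² - b` of an approximate idempotent up to a constant,
because the new defect is `e²(4e - 3)` in terms of the old defect `e`. -/
theorem norm_defect_newtonStep_le {b : A} {ε : ℝ} (hε : ε ≤ 1 / 16) (h : ‖b * b - b‖ ≤ ε) :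
    ‖newtonStep b * newtonStep b - newtonStep b‖ ≤ ε / 4 := by
  set e := b * b - b with he
  have h1 : newtonStep b * newtonStep b - newtonStep b = 4 • (e * e * e) - 3 • (e * e) := by
    rw [he, newtonStep]; noncomm_ring
  have h0 := norm_nonneg e
  have h2 : ‖e * e‖ ≤ ε * ε := (norm_mul_le _ _).trans (by gcongr; linarith)
  have h3 : ‖e * e * e‖ ≤ ε * ε * ε :=
    (norm_mul_le _ _).trans (by have := h0.trans h; gcongr)
  rw [h1]
  refine (norm_sub_le _ _).trans ?_
  have h4 : ‖4 • (e * e * e)‖ ≤ 4 * ‖e * e * e‖ := by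
    simpa using norm_nsmul_le (n := 4) (a := e * e * e)
  have h5 : ‖3 • (e * e)‖ ≤ 3 * ‖e * e‖ := by simpa using norm_nsmul_le (n := 3) (a := e * e)
  have := h0.trans h
  nlinarith [mul_nonneg this this, mul_nonneg (mul_nonneg this this) (sub_nonneg.2 hε),
    mul_nonneg this (sub_nonneg.2 hε)]

theorem norm_newtonStep_sub_le {b : A} (hb : IsSelfAdjoint b) {ε : ℝ} (hε : ε ≤ 1 / 16)
    (h : ‖b * b - b‖ ≤ ε) : ‖newtonStep b - b‖ ≤ 2 * ε := by
  set e := b * b - b with he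
  have h0 := norm_nonneg e
  have hsq : (newtonStep b - b) * (newtonStep b - b) = 4 • (e * e * e) + e * e := by
    rw [he, newtonStep]; noncomm_ring
  have hsa : IsSelfAdjoint (newtonStep b - b) := (isSelfAdjoint_newtonStep hb).sub hb
  have hn : ‖newtonStep b - b‖ * ‖newtonStep b - b‖ = ‖4 • (e * e * e) + e * e‖ := by
    rw [← hsq, ← CStarRing.norm_star_mul_self, hsa.star_eq]
  have h2 : ‖e * e‖ ≤ ε * ε := (norm_mul_le _ _).trans (by gcongr; linarith)
  have h3 : ‖e * e * e‖ ≤ ε * ε * ε :=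
    (norm_mul_le _ _).trans (by have := h0.trans h; gcongr)
  have h4 : ‖4 • (e * e * e)‖ ≤ 4 * ‖e * e * e‖ := by
    simpa using norm_nsmul_le (n := 4) (a := e * e * e)
  have h5 := norm_add_le (4 • (e * e * e)) (e * e)
  have := h0.trans h
  refine le_of_sq_le_sq ?_ (by positivity)
  nlinarith [mul_nonneg this this, mul_nonneg (mul_nonneg this this) (sub_nonneg.2 hε)]

/-- The Newton iteration started near a projection converges geometrically to a projection nearby.
The rate `1/4` matters: it beats the growth `3ⁿ` of the ranks of the defects of the iterates. -/
theorem exists_isStarProjection_newton {P B : A} (hP : IsStarProjection P) (hB : IsSelfAdjoint B)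
    (h : ‖B - P‖ ≤ 1 / 64) :
    ∃ X : A, IsStarProjection X ∧ ‖X - P‖ ≤ 1 / 5 ∧
      ∀ n, ‖newtonStep^[n] B - X‖ ≤ (1 / 4) ^ n := by
  have hPn : ‖P‖ ≤ 1 := hP.norm_le
  have hP2 : P * P = P := hP.isIdempotentElem
  set s : ℕ → A := fun n => newtonStep^[n] B with hs
  have hsucc : ∀ n, s (n + 1) = newtonStep (s n) := fun n => Function.iterate_succ_apply' _ _ _
  have hsa : ∀ n, IsSelfAdjoint (s n) := by
    intro n
    induction n with
    | zero => exact hB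
    | succ n ih => rw [hsucc]; exact isSelfAdjoint_newtonStep ih
  have hdef : ∀ n, ‖s n * s n - s n‖ ≤ 1 / 16 * (1 / 4) ^ n := by
    intro n
    induction n with
    | zero =>
      have e : s 0 * s 0 - s 0 = P * (B - P) + (B - P) * P + (B - P) * (B - P) - (B - P) := by
        have : s 0 * s 0 - s 0 = P * (B - P) + (B - P) * P + (B - P) * (B - P) - (B - P)
          + (P * P - P) := by change B * B - B = _; noncomm_ring
        rw [this, hP2, sub_self, add_zero]
      rw [e]
      have h1 := norm_mul_le P (B - P)
      have h2 := norm_mul_le (B - P) P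
      have h3 := norm_mul_le (B - P) (B - P)
      have h4 := norm_add₃_le (a := P * (B - P)) (b := (B - P) * P) (c := (B - P) * (B - P))
      have h5 := norm_sub_le (P * (B - P) + (B - P) * P + (B - P) * (B - P)) (B - P)
      have := norm_nonneg (B - P)
      have := norm_nonneg P
      nlinarith
    | succ n ih =>
      rw [hsucc]
      have hle : (1 / 4 : ℝ) ^ n ≤ 1 := pow_le_one₀ (by norm_num) (by norm_num)
      refine (norm_defect_newtonStep_le (by linarith) ih).trans (le_of_eq ?_)
      ring
  have hstep : ∀ n, dist (s n) (s (n + 1)) ≤ 1 / 8 * (1 / 4) ^ n := by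
    intro n
    have hle : (1 / 4 : ℝ) ^ n ≤ 1 := pow_le_one₀ (by norm_num) (by norm_num)
    rw [dist_comm, dist_eq_norm, hsucc]
    refine (norm_newtonStep_sub_le (hsa n) (by linarith) (hdef n)).trans (le_of_eq ?_)
    ring
  obtain ⟨X, hX⟩ := cauchySeq_tendsto_of_complete
    (cauchySeq_of_le_geometric (1 / 4) (1 / 8) (by norm_num) hstep)
  have hdist : ∀ n, ‖s n - X‖ ≤ 1 / 6 * (1 / 4) ^ n := by
    intro n
    rw [← dist_eq_norm]
    refine (dist_le_of_le_geometric_of_tendsto (1 / 4) (1 / 8) (by norm_num) hstep hX n).trans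
      (le_of_eq ?_)
    ring
  refine ⟨X, ⟨?_, ?_⟩, ?_, fun n => ?_⟩
  · have h1 : Filter.Tendsto (fun n => s n * s n - s n) Filter.atTop (nhds (X * X - X)) :=
      (hX.mul hX).sub hX
    have h2 : Filter.Tendsto (fun n => s n * s n - s n) Filter.atTop (nhds 0) := by
      refine squeeze_zero_norm hdef ?_
      have h3 := (tendsto_pow_atTop_nhds_zero_of_lt_one (r := (1 / 4 : ℝ)) (by norm_num)
        (by norm_num)).const_mul (1 / 16)
      rwa [mul_zero] at h3
    exact sub_eq_zero.1 (tendsto_nhds_unique h1 h2)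
  · have h1 : Filter.Tendsto (fun n => star (s n)) Filter.atTop (nhds (star X)) := hX.star
    have h2 : (fun n => star (s n)) = s := funext fun n => (hsa n).star_eq
    rw [h2] at h1
    exact tendsto_nhds_unique h1 hX
  · have h1 := hdist 0
    have h2 : X - P = (B - P) - (s 0 - X) := by change _ = (B - P) - (B - X); abel
    rw [h2]
    refine (norm_sub_le _ _).trans ?_
    norm_num at h1 ⊢
    linarith
  · refine (hdist n).trans ?_
    have : (0 : ℝ) ≤ (1 / 4) ^ n := by positivity
    linarith

/-- Nearby projections `X` and `P` are similar: `u = XP + (1 - X)(1 - P)` satisfies `Xu = uP`, and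
it is invertible because `1 - u = (2X - 1)(X - P)`. -/
theorem exists_similar_of_norm_sub_le {X P : A} (hX : IsStarProjection X) (hP : IsStarProjection P)
    (h : ‖X - P‖ ≤ 1 / 5) :
    ∃ u v : A, u = X * P + (1 - X) * (1 - P) ∧ v * u = 1 ∧ X = u * (P * v) ∧
      ∀ a, Commute a u → Commute a v := by
  have hXn : ‖X‖ ≤ 1 := hX.norm_le
  have hX2 : X * X = X := hX.isIdempotentElem
  have hP2 : P * P = P := hP.isIdempotentElem
  have hunit : IsUnit (X * P + (1 - X) * (1 - P)) := by
    have e : X * P + (1 - X) * (1 - P) = 1 - (2 • (X * (X - P)) - (X - P)) := by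
      have : X * P + (1 - X) * (1 - P) =
          1 - (2 • (X * (X - P)) - (X - P)) + 2 • (X * X - X) := by
        noncomm_ring
      rw [this, hX2, sub_self, smul_zero, add_zero]
    rw [e]
    refine isUnit_one_sub_of_norm_lt_one ?_
    have h1 := norm_sub_le (2 • (X * (X - P))) (X - P)
    have h2 : ‖2 • (X * (X - P))‖ ≤ 2 * ‖X * (X - P)‖ := by
      simpa using norm_nsmul_le (n := 2) (a := X * (X - P))
    have h3 := norm_mul_le X (X - P)
    have := norm_nonneg (X - P)
    nlinarith
  obtain ⟨u, hu⟩ := hunit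
  have h1 : X * u = u * P := by
    have e1 : X * (X * P + (1 - X) * (1 - P)) =
        X * X * P + (X - X * X) * (1 - P) := by noncomm_ring
    have e2 : (X * P + (1 - X) * (1 - P)) * P =
        X * (P * P) + (1 - X) * (P - P * P) := by noncomm_ring
    rw [hu, e1, e2, hX2, hP2, sub_self, sub_self, zero_mul, mul_zero]
  exact ⟨u, ↑u⁻¹, hu, u.inv_mul, by rw [← mul_assoc, ← h1, mul_assoc, u.mul_inv, mul_one],
    fun a ha => Commute.units_inv_right ha⟩

end CStar

/-! ### The Cayley tree -/

section Tree

variable {α : Type*} [DecidableEq α]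

open FreeGroup in
/-- Right multiplication by a generator changes the first letter of a reduced word only
for two elements of the group. -/
theorem startsWith_mul_of (w : α × Bool) (x : FreeGroup α) (a : α) (h1 : x ≠ 1)
    (h2 : x ≠ (of a)⁻¹) : x * of a ∈ startsWith w ↔ x ∈ startsWith w := by
  have hne : x.toWord ≠ [] := fun h => h1 (toWord_eq_nil_iff.1 h)
  obtain ⟨L, c, hL⟩ := (List.eq_nil_or_concat x.toWord).resolve_left hne
  rw [List.concat_eq_append] at hL
  have hred : IsReduced (L ++ [c]) := hL ▸ isReduced_toWord
  have hx : (x * of a).toWord = reduce (L ++ [c] ++ [(a, true)]) := by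
    rw [toWord_mul, hL, toWord_of]
  have key : (x * of a).toWord[0]? = x.toWord[0]? := by
    by_cases hc : c = (a, false)
    · have hLne : L ≠ [] := by
        rintro rfl
        apply h2
        apply toWord_injective
        rw [hL, hc, toWord_inv, toWord_of]
        simp [invRev]
      have hLred : IsReduced L := (List.isChain_append.1 hred).1
      have hstep : Red.Step (L ++ [c] ++ [(a, true)]) L := by
        have := @Red.Step.not _ L [] a false
        simpa [hc] using this
      rw [hx, reduce.Step.eq hstep, hLred.reduce_eq, hL]
      cases L with
      | nil => exact absurd rfl hLne
      | cons d L => rfl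
    · have hred' : IsReduced (L ++ [c] ++ [(a, true)]) := by
        refine List.isChain_append.2 ⟨hred, List.isChain_singleton _, ?_⟩
        intro y hy z hz
        simp only [List.getLast?_append, List.getLast?_singleton, Option.some_or,
          Option.mem_some_iff, List.head?_cons] at hy hz
        subst hy hz
        intro h
        by_contra hb
        exact hc (Prod.ext h (by simpa using hb))
      rw [hx, hred'.reduce_eq, hL]
      cases L <;> rfl
  simp only [startsWith, Set.mem_ofPred_eq, key]

open Classical in
/-- The edges of the Cayley tree with vertex set the free group are the pairs `{x, aᵢ x}`.
`farEnd i x` is the endpoint of this edge that is farther from the identity. -/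
noncomputable def farEnd (i : α) (x : FreeGroup α) : FreeGroup α :=
  if x ∈ FreeGroup.startsWith (i, false) then x else FreeGroup.of i * x

theorem farEnd_of_mem {i : α} {x : FreeGroup α} (h : x ∈ FreeGroup.startsWith (i, false)) :
    farEnd i x = x := if_pos h

theorem farEnd_of_notMem {i : α} {x : FreeGroup α} (h : x ∉ FreeGroup.startsWith (i, false)) :
    farEnd i x = FreeGroup.of i * x := if_neg h

theorem of_mul_mem_startsWith {i : α} {x : FreeGroup α}
    (h : x ∉ FreeGroup.startsWith (i, false)) :
    FreeGroup.of i * x ∈ FreeGroup.startsWith (i, true) :=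
  FreeGroup.startsWith_mk_mul (w := (i, true)) x h

theorem farEnd_mem (i : α) (x : FreeGroup α) :
    ∃ b, farEnd i x ∈ FreeGroup.startsWith (i, b) := by
  by_cases h : x ∈ FreeGroup.startsWith (i, false)
  · exact ⟨false, by rwa [farEnd_of_mem h]⟩
  · exact ⟨true, by rw [farEnd_of_notMem h]; exact of_mul_mem_startsWith h⟩

theorem startsWith_unique {v w : α × Bool} {x : FreeGroup α} (hv : x ∈ FreeGroup.startsWith v)
    (hw : x ∈ FreeGroup.startsWith w) : v = w :=
  Option.some_injective _ (Eq.trans (Eq.symm hv) hw)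

theorem farEnd_ne_one (i : α) (x : FreeGroup α) : farEnd i x ≠ 1 := by
  obtain ⟨b, hb⟩ := farEnd_mem i x
  exact FreeGroup.startsWith.ne_one _ hb

/-- A vertex is the far end of at most one edge: the first letter of the vertex determines it. -/
theorem farEnd_inj {i j : α} {x y : FreeGroup α} (h : farEnd i x = farEnd j y) :
    i = j ∧ x = y := by
  have hij : i = j := by
    obtain ⟨b, hb⟩ := farEnd_mem i x
    obtain ⟨c, hc⟩ := farEnd_mem j y
    rw [h] at hb
    exact congrArg Prod.fst (startsWith_unique hb hc)
  subst hij
  refine ⟨rfl, ?_⟩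
  by_cases hx : x ∈ FreeGroup.startsWith (i, false) <;>
    by_cases hy : y ∈ FreeGroup.startsWith (i, false)
  · rwa [farEnd_of_mem hx, farEnd_of_mem hy] at h
  · rw [farEnd_of_mem hx, farEnd_of_notMem hy] at h
    have := startsWith_unique (h ▸ hx) (of_mul_mem_startsWith hy)
    simp at this
  · rw [farEnd_of_notMem hx, farEnd_of_mem hy] at h
    have := startsWith_unique (h ▸ hy) (of_mul_mem_startsWith hx)
    simp at this
  · rw [farEnd_of_notMem hx, farEnd_of_notMem hy] at h
    exact mul_left_cancel h

/-- Every vertex other than the root is the far end of an edge, the first one on the geodesic to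
the root. -/
theorem exists_farEnd_eq {g : FreeGroup α} (hg : g ≠ 1) : ∃ i x, farEnd i x = g := by
  have hne : g.toWord ≠ [] := fun h => hg (FreeGroup.toWord_eq_nil_iff.1 h)
  obtain ⟨⟨i, b⟩, L, hL⟩ := List.exists_cons_of_ne_nil hne
  cases b with
  | false =>
    refine ⟨i, g, farEnd_of_mem ?_⟩
    change g.toWord[0]? = _
    rw [hL]; rfl
  | true =>
    have hred : FreeGroup.IsReduced ((i, true) :: L) := hL ▸ FreeGroup.isReduced_toWord
    have hLred : FreeGroup.IsReduced L := hred.tail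
    have hgL : g = FreeGroup.of i * FreeGroup.mk L := by
      rw [← FreeGroup.mk_toWord (x := g), hL]; rfl
    refine ⟨i, FreeGroup.mk L, ?_⟩
    rw [farEnd_of_notMem, hgL]
    intro hmem
    change (FreeGroup.mk L).toWord[0]? = _ at hmem
    rw [FreeGroup.toWord_mk, hLred.reduce_eq] at hmem
    cases L with
    | nil => simp at hmem
    | cons d L =>
      simp only [List.length_cons, Nat.zero_lt_succ, getElem?_pos, List.getElem_cons_zero,
        Option.some.injEq] at hmem
      subst hmem
      have := (List.isChain_cons_cons.1 hred).1 rfl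
      simp at this

/-- Right translation is an automorphism of the tree that moves the root, so it respects far ends
except at the finitely many edges on a geodesic. The translations `s` for which this holds form a
subgroup, so it is enough to check the generators. -/
theorem finite_farEnd_mul_ne (i : α) (s : FreeGroup α) :
    {x | farEnd i (x * s) ≠ farEnd i x * s}.Finite := by
  have hinv : ∀ s : FreeGroup α, {x | farEnd i (x * s) ≠ farEnd i x * s}.Finite →
      {x | farEnd i (x * s⁻¹) ≠ farEnd i x * s⁻¹}.Finite := by
    intro s hs
    refine (hs.image (· * s)).subset fun x hx => ⟨x * s⁻¹, fun h => hx ?_, by simp⟩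
    rw [inv_mul_cancel_right] at h
    rw [h, mul_inv_cancel_right]
  have hof : ∀ a, {x | farEnd i (x * FreeGroup.of a) ≠ farEnd i x * FreeGroup.of a}.Finite := by
    intro a
    refine (Set.toFinite {1, (FreeGroup.of a)⁻¹}).subset fun x hx => ?_
    by_contra hn
    simp only [Set.mem_insert_iff, Set.mem_singleton_iff, not_or] at hn
    refine hx ?_
    have h := startsWith_mul_of (i, false) x a hn.1 hn.2
    by_cases hm : x ∈ FreeGroup.startsWith (i, false)
    · rw [farEnd_of_mem hm, farEnd_of_mem (h.2 hm)]
    · rw [farEnd_of_notMem hm, farEnd_of_notMem (mt h.1 hm), mul_assoc]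
  induction s using FreeGroup.induction_on with
  | C1 => simp
  | of a => exact hof a
  | inv_of a _ => exact hinv _ (hof a)
  | mul s t hs ht =>
    refine (hs.union (ht.image (· * s⁻¹))).subset fun x hx => ?_
    by_contra hn
    simp only [Set.mem_union, Set.mem_ofPred_eq, not_or, not_not, Set.mem_image] at hn
    have h2 : farEnd i (x * s * t) = farEnd i (x * s) * t := by
      by_contra h
      exact hn.2 ⟨x * s, h, by simp⟩
    exact hx (by rw [← mul_assoc, h2, hn.1, mul_assoc])

end Tree

/-! ### Operators on the vertices and on the edges of the tree -/

variable {ℓ p : ℕ}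

theorem farEnd_injective {α : Type*} [DecidableEq α] (i : α) :
    Function.Injective (farEnd i) := fun _ _ h => (farEnd_inj h).2

theorem memℓp_comp_farEnd (i : Fin ℓ) (f : HSpace ℓ p) :
    Memℓp (fun x : FreeGroup (Fin ℓ) => f (farEnd i x)) 2 := by
  have h2 : (0 : ℝ) < (2 : ℝ≥0∞).toReal := by norm_num
  exact (memℓp_gen_iff h2).2
    (((memℓp_gen_iff h2).1 (lp.memℓp f)).comp_injective (farEnd_injective i))

/-- The coisometry `f ↦ f ∘ farEnd i`, which sends `δ` at the far end of the edge `{x, aᵢ x}` to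
`δ` at `x`, and kills all other `δ`s. -/
noncomputable def pull (p : ℕ) (i : Fin ℓ) : HSpace ℓ p →L[ℂ] HSpace ℓ p :=
  LinearMap.mkContinuous
    { toFun := fun f => ⟨fun x => f (farEnd i x), memℓp_comp_farEnd i f⟩
      map_add' := fun _ _ => rfl
      map_smul' := fun _ _ => rfl } 1 <| by
    intro f
    have h2 : (0 : ℝ) < (2 : ℝ≥0∞).toReal := by norm_num
    rw [one_mul]
    refine lp.norm_le_of_tsum_le h2 (norm_nonneg f) ?_
    rw [lp.norm_rpow_eq_tsum h2]
    have hs := (memℓp_gen_iff h2).1 (lp.memℓp f)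
    exact (hs.comp_injective (farEnd_injective i)).tsum_le_tsum_of_inj _ (farEnd_injective i)
      (fun _ _ => by positivity) (fun _ => le_rfl) hs

@[simp]
theorem pull_apply (i : Fin ℓ) (f : HSpace ℓ p) (x : FreeGroup (Fin ℓ)) :
    pull p i f x = f (farEnd i x) := rfl

theorem norm_pull_le (i : Fin ℓ) : ‖pull p i‖ ≤ 1 :=
  LinearMap.mkContinuous_norm_le _ zero_le_one _

theorem pull_single_farEnd (i j : Fin ℓ) (x : FreeGroup (Fin ℓ)) (φ : EuclideanSpace ℂ (Fin p)) :
    pull p i (lp.single 2 (farEnd j x) φ) = if i = j then lp.single 2 x φ else 0 := by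
  ext y : 2
  rw [pull_apply, lp.coeFn_single]
  by_cases hij : i = j
  · subst hij
    rw [if_pos rfl, lp.coeFn_single]
    by_cases hy : y = x
    · subst hy; simp
    · rw [Pi.single_eq_of_ne hy, Pi.single_eq_of_ne fun h => hy (farEnd_inj h).2]
  · rw [if_neg hij, Pi.single_eq_of_ne fun h => hij (farEnd_inj h).1]
    rfl

theorem pull_single_one (i : Fin ℓ) (φ : EuclideanSpace ℂ (Fin p)) :
    pull p i (lp.single 2 1 φ) = 0 := by
  ext y : 2
  rw [pull_apply, lp.coeFn_single, Pi.single_eq_of_ne (farEnd_ne_one i y)]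
  rfl

theorem star_pull_single (i : Fin ℓ) (x : FreeGroup (Fin ℓ)) (φ : EuclideanSpace ℂ (Fin p)) :
    star (pull p i) (lp.single 2 x φ) = lp.single 2 (farEnd i x) φ := by
  refine ext_inner_right ℂ fun f => ?_
  rw [ContinuousLinearMap.star_eq_adjoint, ContinuousLinearMap.adjoint_inner_left,
    lp.inner_single_left, lp.inner_single_left, pull_apply]

theorem pull_mul_star_pull (i j : Fin ℓ) :
    pull p i * star (pull p j) = if i = j then 1 else 0 := by
  refine lp.ext_continuousLinearMap (by norm_num) fun x => ?_
  ext1 φ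
  change pull p i (star (pull p j) (lp.single 2 x φ)) = (if i = j then 1 else 0 :
    HSpace ℓ p →L[ℂ] HSpace ℓ p) (lp.single 2 x φ)
  rw [star_pull_single, pull_single_farEnd]
  split_ifs <;> rfl

/-- The operator `B` acting on the edges of the Cayley tree, transported to the vertices other than
the root by the far end bijection, and extended by zero to the root. -/
noncomputable def onEdges (B : HSpace ℓ p →L[ℂ] HSpace ℓ p) : HSpace ℓ p →L[ℂ] HSpace ℓ p :=
  ∑ i, star (pull p i) * B * pull p i

theorem onEdges_sub (B C : HSpace ℓ p →L[ℂ] HSpace ℓ p) :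
    onEdges (B - C) = onEdges B - onEdges C := by
  simp only [onEdges, mul_sub, sub_mul, Finset.sum_sub_distrib]

theorem onEdges_nsmul (n : ℕ) (B : HSpace ℓ p →L[ℂ] HSpace ℓ p) :
    onEdges (n • B) = n • onEdges B := by
  simp only [onEdges, mul_smul_comm, smul_mul_assoc, Finset.smul_sum]

theorem onEdges_mul (B C : HSpace ℓ p →L[ℂ] HSpace ℓ p) :
    onEdges (B * C) = onEdges B * onEdges C := by
  have h : ∀ i j, (star (pull p i) * B * pull p i) * (star (pull p j) * C * pull p j) =
      if i = j then star (pull p i) * (B * C) * pull p i else 0 := by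
    intro i j
    have : (star (pull p i) * B * pull p i) * (star (pull p j) * C * pull p j) =
      star (pull p i) * B * (pull p i * star (pull p j)) * C * pull p j := by
      simp only [mul_assoc]
    rw [this, pull_mul_star_pull]
    split_ifs with hij
    · subst hij; simp only [mul_one, mul_assoc]
    · simp
  simp only [onEdges, Finset.sum_mul_sum, h, Finset.sum_ite_eq, Finset.mem_univ, if_true]

theorem star_onEdges (B : HSpace ℓ p →L[ℂ] HSpace ℓ p) : star (onEdges B) = onEdges (star B) := by
  simp only [onEdges, star_sum, star_mul, star_star, mul_assoc]

theorem norm_onEdges_le (B : HSpace ℓ p →L[ℂ] HSpace ℓ p) : ‖onEdges B‖ ≤ ℓ * ‖B‖ := by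
  refine (norm_sum_le _ _).trans ?_
  refine (Finset.sum_le_card_nsmul _ _ ‖B‖ fun i _ =>
    norm_star_mul_mul_le (norm_pull_le i) B).trans (le_of_eq ?_)
  simp

theorem IsStarProjection.onEdges {X : HSpace ℓ p →L[ℂ] HSpace ℓ p} (hX : IsStarProjection X) :
    IsStarProjection (onEdges X) :=
  ⟨by rw [IsIdempotentElem, ← onEdges_mul, hX.isIdempotentElem.eq],
    by rw [IsSelfAdjoint, star_onEdges, hX.isSelfAdjoint.star_eq]⟩

/-- The difference between the actions of `B` on the vertices and on the edges of the tree. -/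
noncomputable def defect (B : HSpace ℓ p →L[ℂ] HSpace ℓ p) : HSpace ℓ p →L[ℂ] HSpace ℓ p :=
  B - onEdges B

/-- A Newton step at most triples the rank of the defect: as `onEdges` is multiplicative, the defect
obeys a twisted Leibniz rule, which writes the new defect as a sum of three terms, each with the old
defect as a factor. -/
theorem finrank_range_defect_newtonStep_le (B : HSpace ℓ p →L[ℂ] HSpace ℓ p)
    (hfin : FiniteDimensional ℂ (LinearMap.range (defect B).toLinearMap)) :
    FiniteDimensional ℂ (LinearMap.range (defect (newtonStep B)).toLinearMap) ∧
      Module.finrank ℂ (LinearMap.range (defect (newtonStep B)).toLinearMap) ≤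
        3 * Module.finrank ℂ (LinearMap.range (defect B).toLinearMap) := by
  set R := LinearMap.range (defect B).toLinearMap with hR
  set Φ := onEdges B with hΦ
  have key : defect (newtonStep B) = defect B * (3 • B - 2 • (B * B)) +
      Φ * (defect B * (3 • 1 - 2 • B)) + (-2 • (Φ * Φ)) * defect B := by
    have h1 : onEdges (newtonStep B) = 3 • (Φ * Φ) - 2 • (Φ * Φ * Φ) := by
      simp only [newtonStep, onEdges_sub, onEdges_nsmul, onEdges_mul, hΦ]
    have h2 : defect B = B - Φ := rfl
    rw [defect, h1, h2, newtonStep]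
    noncomm_ring
  have hle : LinearMap.range (defect (newtonStep B)).toLinearMap ≤
      (R ⊔ R.map Φ.toLinearMap) ⊔ R.map (-2 • (Φ * Φ)).toLinearMap := by
    rintro _ ⟨x, rfl⟩
    rw [key]
    refine Submodule.add_mem_sup (Submodule.add_mem_sup ⟨_, rfl⟩ ?_) ?_
    · exact Submodule.mem_map_of_mem (f := Φ.toLinearMap) ⟨(3 • 1 - 2 • B :
        HSpace ℓ p →L[ℂ] HSpace ℓ p) x, rfl⟩
    · exact Submodule.mem_map_of_mem (f := (-2 • (Φ * Φ)).toLinearMap) ⟨x, rfl⟩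
  refine ⟨Submodule.finiteDimensional_of_le hle, (Submodule.finrank_mono hle).trans ?_⟩
  have h1 := Submodule.finrank_add_le_finrank_add_finrank (R ⊔ R.map Φ.toLinearMap)
    (R.map (-2 • (Φ * Φ)).toLinearMap)
  have h2 := Submodule.finrank_add_le_finrank_add_finrank R (R.map Φ.toLinearMap)
  have h3 := Submodule.finrank_map_le Φ.toLinearMap R
  have h4 := Submodule.finrank_map_le (-2 • (Φ * Φ)).toLinearMap R
  omega

/-- An operator on `ℓ²` that vanishes on all but finitely many of the coordinate subspaces has
finite rank. -/
theorem finiteDimensional_range_of_single (K : HSpace ℓ p →L[ℂ] HSpace ℓ p)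
    {S : Set (FreeGroup (Fin ℓ))} (hS : S.Finite)
    (hK : ∀ g ∉ S, ∀ φ, K (lp.single 2 g φ) = 0) :
    FiniteDimensional ℂ (LinearMap.range K.toLinearMap) := by
  let L : FreeGroup (Fin ℓ) → EuclideanSpace ℂ (Fin p) →ₗ[ℂ] HSpace ℓ p := fun g =>
    (K.comp (lp.singleContinuousLinearMap ℂ
      (fun _ : FreeGroup (Fin ℓ) => EuclideanSpace ℂ (Fin p)) 2 g)).toLinearMap
  have hle : LinearMap.range K.toLinearMap ≤ ⨆ g ∈ hS.toFinset, LinearMap.range (L g) := by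
    rintro _ ⟨f, rfl⟩
    have h1 := K.hasSum (lp.hasSum_single (p := 2) (by norm_num) f)
    have h2 : HasSum (fun g => K (lp.single 2 g (f g)))
        (∑ g ∈ hS.toFinset, K (lp.single 2 g (f g))) :=
      hasSum_sum_of_ne_finset_zero fun g hg => hK g (by simpa using hg) _
    change K f ∈ _
    rw [h1.unique h2]
    exact Submodule.sum_mem _ fun g hg =>
      (le_iSup₂ (f := fun g (_ : g ∈ hS.toFinset) => LinearMap.range (L g)) g hg) ⟨f g, rfl⟩
  have : FiniteDimensional ℂ (⨆ g ∈ hS.toFinset, LinearMap.range (L g) :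
      Submodule ℂ (HSpace ℓ p)) := by
    rw [← Finset.sup_eq_iSup]
    exact Submodule.finiteDimensional_finset_sup _ _
  exact Submodule.finiteDimensional_of_le hle

theorem apply_single_eq_sum {B : HSpace ℓ p →L[ℂ] HSpace ℓ p} (hB : B ∈ V ℓ p)
    (hfin : {w | hat B w ≠ 0}.Finite) (x : FreeGroup (Fin ℓ)) (φ : EuclideanSpace ℂ (Fin p)) :
    B (lp.single 2 x φ) = ∑ s ∈ hfin.toFinset, lp.single 2 (x * s) (hat B s φ) := by
  ext h : 2
  rw [apply_single hB, lp.coeFn_sum, Finset.sum_apply]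
  rw [Finset.sum_eq_single (x⁻¹ * h)]
  · rw [lp.coeFn_single, mul_inv_cancel_left, Pi.single_eq_same]
  · intro s _ hs
    rw [lp.coeFn_single, Pi.single_eq_of_ne]
    rintro rfl
    exact hs (by simp)
  · intro hn
    have : hat B (x⁻¹ * h) = 0 := by simpa using hn
    rw [this, lp.coeFn_single]
    simp

theorem onEdges_single_farEnd (B : HSpace ℓ p →L[ℂ] HSpace ℓ p) (i : Fin ℓ)
    (x : FreeGroup (Fin ℓ)) (φ : EuclideanSpace ℂ (Fin p)) :
    onEdges B (lp.single 2 (farEnd i x) φ) = star (pull p i) (B (lp.single 2 x φ)) := by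
  rw [onEdges, sum_apply, Finset.sum_eq_single i]
  · change star (pull p i) (B (pull p i _)) = _
    rw [pull_single_farEnd, if_pos rfl]
  · intro j _ hj
    change star (pull p j) (B (pull p j _)) = _
    rw [pull_single_farEnd, if_neg hj, map_zero, map_zero]
  · simp

/-- Convolution operators of finite support act in the same way on vertices and on edges, up to
finite rank. -/
theorem finiteDimensional_range_defect {B : HSpace ℓ p →L[ℂ] HSpace ℓ p} (hB : B ∈ C0 ℓ p) :
    FiniteDimensional ℂ (LinearMap.range (defect B).toLinearMap) := by
  obtain ⟨hV, hfin⟩ := hB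
  refine finiteDimensional_range_of_single (defect B) (S := insert 1 (⋃ i, ⋃ s ∈ hfin.toFinset,
    farEnd i '' {x | farEnd i (x * s) ≠ farEnd i x * s})) ?_ ?_
  · refine Set.Finite.insert _ (Set.finite_iUnion fun i => Set.Finite.biUnion
      (Finset.finite_toSet _) fun s _ => (finite_farEnd_mul_ne i s).image _)
  · intro g hg φ
    simp only [Set.mem_insert_iff, Set.mem_iUnion, not_or, not_exists] at hg
    obtain ⟨i, x, rfl⟩ := exists_farEnd_eq hg.1
    rw [defect, sub_apply, onEdges_single_farEnd, apply_single_eq_sum hV hfin,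
      apply_single_eq_sum hV hfin, map_sum, sub_eq_zero]
    refine Finset.sum_congr rfl fun s hs => ?_
    rw [star_pull_single]
    by_contra hne
    refine hg.2 i s hs ⟨x, fun h => hne ?_, rfl⟩
    rw [h]

/-! ### The trace -/

/-- The Hilbert basis `δ_{g; e_k}` of `ℓ²(F_ℓ; ℂᵖ)`. -/
theorem exists_hilbertBasis_single (ℓ p : ℕ) :
    ∃ b : HilbertBasis (FreeGroup (Fin ℓ) × Fin p) ℂ (HSpace ℓ p),
      ∀ i, b i = lp.single 2 i.1 (EuclideanSpace.basisFun (Fin p) ℂ i.2) := by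
  have hon : Orthonormal ℂ (fun i : FreeGroup (Fin ℓ) × Fin p =>
      (lp.single 2 i.1 (EuclideanSpace.basisFun (Fin p) ℂ i.2) : HSpace ℓ p)) := by
    classical
    rw [orthonormal_iff_ite]
    rintro ⟨g, k⟩ ⟨h, m⟩
    rw [lp.inner_single_left, lp.coeFn_single]
    by_cases hgh : g = h
    · subst hgh
      rw [Pi.single_eq_same, orthonormal_iff_ite.1 (EuclideanSpace.basisFun (Fin p) ℂ).orthonormal]
      simp
    · rw [Pi.single_eq_of_ne hgh, inner_zero_right, if_neg]
      simp [hgh]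
  refine ⟨HilbertBasis.mkOfOrthogonalEqBot hon ?_, fun i => by simp⟩
  rw [Submodule.eq_bot_iff]
  intro f hf
  ext g : 2
  refine InnerProductSpace.ext_inner_left_basis (EuclideanSpace.basisFun (Fin p) ℂ).toBasis
    fun k => ?_
  have := (Submodule.mem_orthogonal _ _).1 hf _ (Submodule.subset_span ⟨(g, k), rfl⟩)
  rw [lp.inner_single_left] at this
  simpa using this

theorem inner_single_apply {B : HSpace ℓ p →L[ℂ] HSpace ℓ p} (hB : B ∈ V ℓ p)
    (g : FreeGroup (Fin ℓ)) (φ : EuclideanSpace ℂ (Fin p)) :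
    inner ℂ (lp.single 2 g φ) (B (lp.single 2 g φ)) = inner ℂ φ (hat B 1 φ) := by
  rw [lp.inner_single_left, apply_single hB, inv_mul_cancel]

theorem T_eq_sum_inner (B : HSpace ℓ p →L[ℂ] HSpace ℓ p) :
    T B = ∑ k, inner ℂ (EuclideanSpace.basisFun (Fin p) ℂ k)
      (hat B 1 (EuclideanSpace.basisFun (Fin p) ℂ k)) :=
  LinearMap.trace_eq_sum_inner _ _

/-- The diagonal of the defect vanishes away from the root, which is not the far end of an edge,
and its entry at the root is `B̂(e)`. So the trace of the defect is `T(B)`. -/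
theorem hasSum_inner_defect {B : HSpace ℓ p →L[ℂ] HSpace ℓ p} (hB : B ∈ V ℓ p)
    (b : HilbertBasis (FreeGroup (Fin ℓ) × Fin p) ℂ (HSpace ℓ p))
    (hb : ∀ i, b i = lp.single 2 i.1 (EuclideanSpace.basisFun (Fin p) ℂ i.2)) :
    HasSum (fun i => inner ℂ (b i) (defect B (b i))) (T B) := by
  have h0 : ∀ i ∉ ({1} : Finset (FreeGroup (Fin ℓ))) ×ˢ (Finset.univ : Finset (Fin p)),
      inner ℂ (b i) (defect B (b i)) = 0 := by
    rintro ⟨g, k⟩ hg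
    have hg1 : g ≠ 1 := by simpa [eq_comm] using hg
    obtain ⟨i, x, rfl⟩ := exists_farEnd_eq hg1
    rw [hb, defect, sub_apply, inner_sub_right, inner_single_apply hB, onEdges_single_farEnd,
      ContinuousLinearMap.star_eq_adjoint, ContinuousLinearMap.adjoint_inner_right,
      pull_single_farEnd, if_pos rfl, inner_single_apply hB, sub_self]
  have h1 := hasSum_sum_of_ne_finset_zero (L := SummationFilter.unconditional _) h0
  rw [Finset.sum_product, Finset.sum_singleton] at h1
  rw [T_eq_sum_inner]
  convert h1 using 2 with k
  have h2 : onEdges B (lp.single 2 1 (EuclideanSpace.basisFun (Fin p) ℂ k)) = 0 := by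
    rw [onEdges, sum_apply]
    refine Finset.sum_eq_zero fun i _ => ?_
    change star (pull p i) (B (pull p i _)) = 0
    rw [pull_single_one, map_zero, map_zero]
  rw [hb, defect, sub_apply, h2, sub_zero, inner_single_apply hB]

theorem continuous_T : Continuous (T : (HSpace ℓ p →L[ℂ] HSpace ℓ p) → ℂ) := by
  have : (T : (HSpace ℓ p →L[ℂ] HSpace ℓ p) → ℂ) = fun B => ∑ k,
      inner ℂ (EuclideanSpace.basisFun (Fin p) ℂ k)
        (hat B 1 (EuclideanSpace.basisFun (Fin p) ℂ k)) := funext T_eq_sum_inner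
  rw [this]
  refine continuous_finsetSum _ fun k _ => continuous_const.inner ?_
  exact (lp.evalCLM ℂ (fun _ : FreeGroup (Fin ℓ) => EuclideanSpace ℂ (Fin p)) 2 1).continuous.comp
    (ContinuousLinearMap.apply ℂ (HSpace ℓ p) (lp.single 2 1 _)).continuous

/-- `T(BC) = ∑_h Tr(B̂(h⁻¹) Ĉ(h))`, the value at the identity of the convolution. -/
theorem hasSum_trace_hat_mul {B C : HSpace ℓ p →L[ℂ] HSpace ℓ p} (hB : B ∈ V ℓ p) :
    HasSum (fun h => LinearMap.trace ℂ _ ((hat B h⁻¹).toLinearMap * (hat C h).toLinearMap))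
      (T (B * C)) := by
  rw [T_eq_sum_inner]
  simp_rw [LinearMap.trace_eq_sum_inner _ (EuclideanSpace.basisFun (Fin p) ℂ)]
  refine hasSum_sum fun k _ => ?_
  have h := hasSum_hat hB (C (lp.single 2 1 (EuclideanSpace.basisFun (Fin p) ℂ k))) 1
  simp only [mul_one] at h
  exact (innerSL ℂ (EuclideanSpace.basisFun (Fin p) ℂ k)).hasSum h

theorem T_mul_comm {B C : HSpace ℓ p →L[ℂ] HSpace ℓ p} (hB : B ∈ V ℓ p) (hC : C ∈ V ℓ p) :
    T (B * C) = T (C * B) := by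
  have h1 := hasSum_trace_hat_mul (C := C) hB
  have h2 := (Equiv.inv (FreeGroup (Fin ℓ))).hasSum_iff.2 (hasSum_trace_hat_mul (C := B) hC)
  refine h1.unique (h2.congr_fun fun h => ?_)
  simp [LinearMap.trace_mul_comm ℂ (hat B h⁻¹).toLinearMap]

theorem isClosed_V : IsClosed {B : HSpace ℓ p →L[ℂ] HSpace ℓ p | B ∈ V ℓ p} := by
  simp only [mem_V_iff, Set.ofPred_forall]
  exact isClosed_iInter fun g =>
    isClosed_eq (continuous_const.mul continuous_id) (continuous_id.mul continuous_const)

/-- `T` takes the same value on nearby projections, since they are similar in `𝒱`. -/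
theorem T_eq_of_norm_sub_le {X P : HSpace ℓ p →L[ℂ] HSpace ℓ p} (hXV : X ∈ V ℓ p)
    (hPV : P ∈ V ℓ p) (hX : IsStarProjection X) (hP : IsStarProjection P)
    (h : ‖X - P‖ ≤ 1 / 5) : T X = T P := by
  obtain ⟨u, v, hu, hvu, hXu, hcomm⟩ := exists_similar_of_norm_sub_le hX hP h
  have huV : u ∈ V ℓ p := by
    rw [hu]
    exact add_mem (mul_mem hXV hPV)
      (mul_mem (sub_mem (one_mem _) hXV) (sub_mem (one_mem _) hPV))
  have hvV : v ∈ V ℓ p := mem_V_iff.2 fun g => hcomm _ (mem_V_iff.1 huV g)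
  calc T X = T (u * (P * v)) := by rw [← hXu]
    _ = T ((P * v) * u) := T_mul_comm huV (mul_mem hPV hvV)
    _ = T P := by rw [mul_assoc, hvu, mul_one]

theorem newtonStep_mem_C0 {B : HSpace ℓ p →L[ℂ] HSpace ℓ p} (hB : B ∈ C0 ℓ p) :
    newtonStep B ∈ C0 ℓ p :=
  sub_mem (nsmul_mem (mul_mem hB hB) _) (nsmul_mem (mul_mem (mul_mem hB hB) hB) _)

theorem exists_isSelfAdjoint_mem_C0 {P : HSpace ℓ p →L[ℂ] HSpace ℓ p} (hmem : P ∈ Cred ℓ p)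
    (hP : IsSelfAdjoint P) {ε : ℝ} (hε : 0 < ε) :
    ∃ B ∈ C0 ℓ p, IsSelfAdjoint B ∧ ‖B - P‖ ≤ ε := by
  have hcl : P ∈ closure (C0 ℓ p : Set (HSpace ℓ p →L[ℂ] HSpace ℓ p)) := hmem
  obtain ⟨C, hC, hCP⟩ := Metric.mem_closure_iff.1 hcl ε hε
  rw [dist_comm, dist_eq_norm] at hCP
  refine ⟨(2⁻¹ : ℂ) • (C + star C), (C0 ℓ p).smul_mem (add_mem hC (star_mem hC)) _, ?_, ?_⟩
  · simp [IsSelfAdjoint, add_comm]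
  · exact (norm_half_add_star_sub_le C hP).trans hCP.le

end FreeGroupAlgebra

open FreeGroupAlgebra in
theorem theoremA3 (ℓ p : ℕ) (hℓ : 1 ≤ ℓ) (hp : 1 ≤ p)
    (P : FreeGroupAlgebra.HSpace ℓ p →L[ℂ] FreeGroupAlgebra.HSpace ℓ p)
    (hmem : P ∈ FreeGroupAlgebra.Cred ℓ p) (hP : IsStarProjection P) :
    ∃ n : ℤ, FreeGroupAlgebra.T P = (n : ℂ) := by
  -- `1 / 64` is the distance from which the Newton iteration is known to converge
  obtain ⟨B, hB, hBsa, hBP⟩ := exists_isSelfAdjoint_mem_C0 hmem hP.isSelfAdjoint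
    (ε := 1 / 64) (by norm_num)
  obtain ⟨X, hX, hXP, hlim⟩ := exists_isStarProjection_newton hP hBsa hBP
  obtain ⟨b, hb⟩ := exists_hilbertBasis_single ℓ p
  set s : ℕ → (HSpace ℓ p →L[ℂ] HSpace ℓ p) := fun n => newtonStep^[n] B with hs
  set r := Module.finrank ℂ (LinearMap.range (defect B).toLinearMap) with hr
  have hsucc : ∀ n, s (n + 1) = newtonStep (s n) := fun n => Function.iterate_succ_apply' _ _ _
  have hsC : ∀ n, s n ∈ C0 ℓ p := by
    intro n
    induction n with
    | zero => exact hB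
    | succ n ih => rw [hsucc]; exact newtonStep_mem_C0 ih
  have hrank : ∀ n, FiniteDimensional ℂ (LinearMap.range (defect (s n)).toLinearMap) ∧
      Module.finrank ℂ (LinearMap.range (defect (s n)).toLinearMap) ≤ 3 ^ n * r := by
    intro n
    induction n with
    | zero => exact ⟨finiteDimensional_range_defect hB, by rw [pow_zero, one_mul]; exact le_rfl⟩
    | succ n ih =>
      rw [hsucc]
      obtain ⟨h1, h2⟩ := finrank_range_defect_newtonStep_le (s n) ih.1
      refine ⟨h1, h2.trans ?_⟩
      rw [pow_succ]
      linarith [ih.2]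
  have htend : Filter.Tendsto s Filter.atTop (nhds X) := by
    rw [tendsto_iff_norm_sub_tendsto_zero]
    exact squeeze_zero (fun _ => norm_nonneg _) hlim
      (tendsto_pow_atTop_nhds_zero_of_lt_one (by norm_num) (by norm_num))
  have hXV : X ∈ V ℓ p := isClosed_V.mem_of_tendsto htend (Filter.Eventually.of_forall
    fun n => (hsC n).1)
  have hPV : P ∈ V ℓ p := by
    have hcl : P ∈ closure (C0 ℓ p : Set (HSpace ℓ p →L[ℂ] HSpace ℓ p)) := hmem
    exact closure_minimal (fun C hC => hC.1) isClosed_V hcl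
  -- rank `3ⁿ r` times distance `(1 + ℓ) / 4ⁿ` from a difference of projections
  have hint : ∀ n, ∃ k : ℤ, ‖T (s n) - k‖ ≤ (6 * r * (1 + ℓ)) * (3 / 4) ^ n := by
    intro n
    have := (hrank n).1
    have hbound : ‖X - onEdges X - defect (s n)‖ ≤ (1 + ℓ) * (1 / 4) ^ n := by
      have e : X - onEdges X - defect (s n) = -((s n - X) - onEdges (s n - X)) := by
        rw [defect, onEdges_sub]; abel
      rw [e, norm_neg]
      have h1 := norm_sub_le (s n - X) (onEdges (s n - X))
      have h2 := norm_onEdges_le (s n - X)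
      have h3 : (ℓ : ℝ) * ‖s n - X‖ ≤ ℓ * (1 / 4) ^ n := by gcongr; exact hlim n
      linarith [hlim n]
    obtain ⟨k, hk⟩ := exists_int_norm_trace_sub_le b hX (IsStarProjection.onEdges hX) (hrank n).2
      (by positivity) hbound (hasSum_inner_defect (hsC n).1 b hb)
    refine ⟨k, hk.trans (le_of_eq ?_)⟩
    have : (3 / 4 : ℝ) ^ n = 3 ^ n * (1 / 4) ^ n := by rw [← mul_pow]; norm_num
    rw [this]
    push_cast
    ring
  choose k hk using hint
  have hdiff : Filter.Tendsto (fun n => T (s n) - k n) Filter.atTop (nhds 0) := by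
    refine squeeze_zero_norm hk ?_
    have h := (tendsto_pow_atTop_nhds_zero_of_lt_one (r := (3 / 4 : ℝ)) (by norm_num)
      (by norm_num)).const_mul (6 * r * (1 + ℓ) : ℝ)
    rwa [mul_zero] at h
  have hT : Filter.Tendsto (fun n => T (s n)) Filter.atTop (nhds (T X)) :=
    (continuous_T.tendsto X).comp htend
  have hk' : Filter.Tendsto (fun n => (k n : ℂ)) Filter.atTop (nhds (T X)) := by
    simpa using hT.sub hdiff
  obtain ⟨n, hn⟩ := Complex.isClosedEmbedding_intCast.isClosed_range.mem_of_tendsto hk'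
    (Filter.Eventually.of_forall fun n => ⟨k n, rfl⟩)
  exact ⟨n, by rw [← T_eq_of_norm_sub_le hXV hPV hX hP hXP, ← hn]⟩
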